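/- Let $m$ be a natural number and let $X_1,\dots,X_m$ be real separated (Hausdorff) locally convex spaces, with topological duals $X_i^*$ endowed with the weak$^*$ topology; identify the dual of $\prod_{i=1}^m X_i$ with $\prod_{i=1}^m X_i^*$ (with the product topology) through $\langle (x_1^*,\dots,x_m^*),(x_1,\dots,x_m)\rangle=\sum_{i=1}^m\langle x_i^*,x_i\rangle$. For a function $f:X\to\overline{\mathbb R}=\mathbb R\cup\{\pm\infty\}$ on a separated locally convex space $X$ put $\operatorname{dom} f=\{x: f(x)<+\infty\}$ and $\operatorname{epi} f=\{(x,r)\in X\times\mathbb R: f(x)\le r\}$. Call $f$ proper if $f>-\infty$ everywhere and $\operatorname{dom} f\ne\emptyset$, and convex if $\operatorname{epi} f$ is convex. Let $\operatorname{cl} f$ be its lower semicontinuous hull, i.e. the function whose epigraph is the closure of $\operatorname{epi} f$, and let $f^*(x^*)=\sup_{x\in X}\{\langle x^*,x\rangle-f(x)\}$ for $x^*\in X^*$ be its conjugate. For $\varepsilon\ge 0$ let $$\partial_\varepsilon f(x)=\{x^*\in X^*: f(y)-f(x)\ge\langle x^*,y-x\rangle-\varepsilon\ \ \forall y\in X\}$$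 if $f(x)\in\mathbb R$, and $\partial_\varepsilon f(x)=\emptyset$ if $f(x)=\pm\infty$. **Theorem.** Let $f_i:X_i\to\overline{\mathbb R}$ be proper and convex functions, $i=1,\dots,m$, let $S\subseteq\prod_{i=1}^m X_i$ be a closed linear subspace with $\left(\prod_{i=1}^m\operatorname{dom} f_i\right)\cap S\neq\emptyset$, let $S^\perp=\{x^*\in\prod_{i=1}^m X_i^*:\langle x^*,x\rangle=0\ \ \forall x\in S\}$, and define $g:\prod_{i=1}^m X_i\to\overline{\mathbb R}$ by $g(x_1,\dots,x_m)=\sum_{i=1}^m f_i(x_i)$. Suppose that every $\operatorname{cl} f_i$ is proper and that $g(x)=(\operatorname{cl} g)(x)$ for all $x\in\operatorname{dom}(\operatorname{cl} g)\cap S$. If for all $(x_1,\dots,x_m)\in\left(\prod_{i=1}^m\operatorname{dom} f_i\right)\cap S$ and all $\varepsilon>0$ the set $$S^\perp+\prod_{i=1}^m\partial_\varepsilon f_i(x_i)$$ is closed in $\prod_{i=1}^m X_i^*$, then $v(P)=v(D)$, where $$v(P)=\inf_{(x_1,\dots,x_m)\in S}\ \sum_{i=1}^m f_i(x_i),\qquad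 v(D)=\sup_{(x_1^*,\dots,x_m^*)\in S^\perp}\ \sum_{i=1}^m -f_i^*(x_i^*).$$ -/

import Mathlib

open scoped Pointwise

noncomputable section

namespace ExtMonotropic

section Single

variable {X : Type*}

/-- The (effective) domain `{x | f x < +∞}`. -/
def dom (f : X → EReal) : Set X := {x | f x < ⊤}

/-- The epigraph `{(x, r) ∈ X × ℝ | f x ≤ r}`. -/
def epi (f : X → EReal) : Set (X × ℝ) := {p | f p.1 ≤ (p.2 : EReal)}

/-- `f` is proper: it never takes the value `-∞` and its domain is nonempty. -/
def IsProper (f : X → EReal) : Prop := (∀ x, ⊥ < f x) ∧ (dom f).Nonempty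

/-- An extended-real-valued function is convex if its epigraph is a convex set. -/
def IsConvex [AddCommGroup X] [Module ℝ X] (f : X → EReal) : Prop := Convex ℝ (epi f)

/-- The lower semicontinuous hull `cl f`, i.e. the function whose epigraph is the closure of the
epigraph of `f` (see `epi_lscHull`). -/
def lscHull [TopologicalSpace X] (f : X → EReal) (x : X) : EReal :=
  ⨅ r ∈ {r : ℝ | (x, r) ∈ closure (epi f)}, (r : EReal)

theorem epi_lscHull [TopologicalSpace X] (f : X → EReal) : epi (lscHull f) = closure (epi f) := by
  ext ⟨x, r⟩
  constructor
  · intro h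
    have h' : lscHull f x ≤ (r : EReal) := h
    have key : ∀ s : ℝ, r < s → (x, s) ∈ closure (epi f) := by
      intro s hs
      have h1 : lscHull f x < (s : EReal) := lt_of_le_of_lt h' (EReal.coe_lt_coe_iff.2 hs)
      simp only [lscHull, iInf_lt_iff] at h1
      obtain ⟨t, ht, hts⟩ := h1
      have hts' : t ≤ s := (EReal.coe_lt_coe_iff.1 hts).le
      have hc : Continuous fun p : X × ℝ => (p.1, p.2 + (s - t)) := by fun_prop
      have := map_mem_closure (t := epi f) hc ht (by
        intro p hp
        have hp' : f p.1 ≤ (p.2 : EReal) := hp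
        exact hp'.trans (EReal.coe_le_coe_iff.2 (by linarith)))
      simpa using this
    have hr : r ∈ closure (Set.Ioi r) := by rw [closure_Ioi]; exact Set.self_mem_Ici
    have hc : Continuous fun s : ℝ => (x, s) := by fun_prop
    have := map_mem_closure (t := closure (epi f)) hc hr (fun s hs => key s hs)
    rwa [closure_closure] at this
  · intro h
    exact iInf₂_le (f := fun (s : ℝ) (_ : (x, s) ∈ closure (epi f)) => (s : EReal)) r h

variable [AddCommGroup X] [Module ℝ X] [TopologicalSpace X]

/-- The conjugate `f^*(x^*) = sup {⟨x^*, x⟩ - f x | x ∈ X}` on the topological dual. -/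
def conj (f : X → EReal) (p : WeakDual ℝ X) : EReal :=
  ⨆ x : X, (((p x : ℝ) : EReal) - f x)

/-- The `ε`-subdifferential of `f` at `x`, which is empty by convention if `f x = ±∞`. -/
def epsSubdiff (ε : ℝ) (f : X → EReal) (x : X) : Set (WeakDual ℝ X) :=
  {p | f x ≠ ⊥ ∧ f x ≠ ⊤ ∧ ∀ y : X, ((p (y - x) - ε : ℝ) : EReal) ≤ f y - f x}

end Single

section Product

variable {m : ℕ} {X : Fin m → Type*}

/-- The separable sum `g(x₁, …, xₘ) = ∑ fᵢ(xᵢ)`. -/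
def sepSum (f : ∀ i, X i → EReal) (x : ∀ i, X i) : EReal := ∑ i, f i (x i)

variable [∀ i, AddCommGroup (X i)] [∀ i, Module ℝ (X i)]

/-- The optimal value `v(P)` of the primal problem: the infimum of `∑ fᵢ(xᵢ)` over `S`. -/
def primalValue (f : ∀ i, X i → EReal) (S : Submodule ℝ (∀ i, X i)) : EReal :=
  ⨅ x ∈ S, ∑ i, f i (x i)

variable [∀ i, TopologicalSpace (X i)]

/-- The orthogonal space `S^⊥`, as a subset of `∏ Xᵢ^*`, which is identified with the dual of
`∏ Xᵢ` through `⟨x^*, x⟩ = ∑ ⟨xᵢ^*, xᵢ⟩`; under this identification, the product of the weak-*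
topologies is the weak-* topology. -/
def orthogonal (S : Submodule ℝ (∀ i, X i)) : Set (∀ i, WeakDual ℝ (X i)) :=
  {p | ∀ x ∈ S, ∑ i, p i (x i) = 0}

/-- The optimal value `v(D)` of the dual problem: the supremum of `∑ -fᵢ^*(xᵢ^*)` over `S^⊥`. -/
def dualValue (f : ∀ i, X i → EReal) (S : Submodule ℝ (∀ i, X i)) : EReal :=
  ⨆ p ∈ orthogonal S, ∑ i, -conj (f i) (p i)

end Product

end ExtMonotropic

end

/-!
Weak duality holds term by term, so only `v(P) ≤ v(D)` with `v(P)` real needs work. Write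
`g = ∑ fᵢ` and let `ε > 0`. Choose `x ∈ S` with `g x < v(P) + ε`. If

  `0 ∈ S^⊥ + ∏ ∂_ε fᵢ(xᵢ)`,

then some `q ∈ S^⊥` has all its components `qᵢ ∈ ∂_ε fᵢ(xᵢ)`, and summing the inequalities
`-fᵢ^*(qᵢ) ≥ fᵢ(xᵢ) - ⟨qᵢ, xᵢ⟩ - ε` gives `v(D) ≥ v(P) - mε`; then let `ε → 0`.

Since the set above is closed by hypothesis, it suffices that `0` lies in its weak-* closure. By
Hahn–Banach and `S^⊥⊥ = S`, this holds as soon as for every `d ∈ S` and `η > 0` some element `q` of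
the set `∏ ∂_ε fᵢ(xᵢ)` satisfies `⟨q, d⟩ > -η` (`zero_mem_closure_orthogonal_add`). Such a `q` is
found in `∂_ε g(x)`, which is contained in the product (`component_mem_epsSubdiff`). Because `g` and
`cl g` agree on `dom (cl g) ∩ S`, we have `cl g ≥ v(P) > g x - ε` on `S`, in particular along the
ray from `x` in direction `d`. Translate `epi (cl g)` to a closed convex set `A` by moving
`(x, g x - ε)` to the origin. The cone generated by `A` need not be closed, but since the ray
spanned by `(d, -η)` misses `A` and `(d, -η)` is not a recession direction of `A`, this vector is
not in the closure of the cone either (`notMem_closure_hull`). A hyperplane separating the two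
yields `q` (`exists_linear_minorant`, `exists_mem_epsSubdiff_lt`).
-/

open Filter Topology

namespace ExtMonotropic

/-! ### Closed convex sets and the cones they generate -/

theorem mem_hull_iff_exists_smul_mem {E : Type*} [AddCommGroup E] [Module ℝ E] {A : Set E}
    (hA : Convex ℝ A) {z : E} :
    z ∈ (ConvexCone.hull ℝ A : Set E) ↔ ∃ c : ℝ, 0 < c ∧ c • z ∈ A := by
  rw [SetLike.mem_coe, ConvexCone.mem_hull_of_convex hA]
  constructor
  · rintro ⟨c, hc, y, hy, rfl⟩
    exact ⟨c⁻¹, inv_pos.2 hc, by simpa [smul_smul, inv_mul_cancel₀ hc.ne'] using hy⟩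
  · rintro ⟨c, hc, h⟩
    exact ⟨c⁻¹, inv_pos.2 hc, c • z, h, by simp [smul_smul, inv_mul_cancel₀ hc.ne']⟩

theorem smul_mem_hull {E : Type*} [AddCommGroup E] [Module ℝ E] {A : Set E} {a : E} (ha : a ∈ A)
    {c : ℝ} (hc : 0 < c) : c • a ∈ (ConvexCone.hull ℝ A : Set E) :=
  (ConvexCone.hull ℝ A).smul_mem hc (ConvexCone.subset_hull ha)

/-- If a closed convex set `A` does not contain `0`, the closure of the cone it generates consists of
the positive multiples of points of `A` and the recession directions of `A`. Here `hz` says that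
`0 ∉ A` (case `s = 0`) and that `z` is not a positive multiple of a point of `A`, and `hrec` that `z`
is not a recession direction. -/
theorem notMem_closure_hull {E : Type*} [AddCommGroup E] [Module ℝ E] [TopologicalSpace E]
    [IsTopologicalAddGroup E] [ContinuousSMul ℝ E] {A : Set E} (hA : Convex ℝ A)
    (hAc : IsClosed A) {a z : E} (ha : a ∈ A) (hz : ∀ s : ℝ, 0 ≤ s → s • z ∉ A)
    (hrec : ∃ s : ℝ, 0 ≤ s ∧ a + s • z ∉ A) : z ∉ closure (ConvexCone.hull ℝ A : Set E) := by
  intro hmem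
  obtain ⟨U, hU, hUz⟩ := mem_closure_iff_ultrafilter.1 hmem
  -- Scale the points of the cone converging to `z` into `A`; after passing to an ultrafilter either
  -- the factors or their inverses converge in `[0, 1]`.
  have hex : ∀ y : E, ∃ c : ℝ, y ∈ (ConvexCone.hull ℝ A : Set E) → 0 < c ∧ c • y ∈ A := by
    intro y
    by_cases hy : y ∈ (ConvexCone.hull ℝ A : Set E)
    · obtain ⟨c, hc, hcy⟩ := (mem_hull_iff_exists_smul_mem hA).1 hy
      exact ⟨c, fun _ => ⟨hc, hcy⟩⟩
    · exact ⟨0, fun h => absurd h hy⟩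
  choose c hc using hex
  have hid : Tendsto (fun y : E => y) U (𝓝 z) := hUz
  have hcpos : ∀ᶠ y in (U : Filter E), 0 < c y := by filter_upwards [hU] with y hy using (hc y hy).1
  have hcA : ∀ᶠ y in (U : Filter E), c y • y ∈ A := by
    filter_upwards [hU] with y hy using (hc y hy).2
  have hlim : ∀ s : ℝ, 0 ≤ s → ¬ Tendsto c U (𝓝 s) := fun s hs h =>
    hz s hs (hAc.mem_of_tendsto (h.smul hid) hcA)
  have hIcc : ∀ φ : E → ℝ, (∀ᶠ y in (U : Filter E), φ y ∈ Set.Icc (0 : ℝ) 1) →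
      ∃ s : ℝ, 0 ≤ s ∧ Tendsto φ U (𝓝 s) := by
    intro φ hφ
    obtain ⟨s, hs, hs'⟩ := (isCompact_Icc (a := (0 : ℝ)) (b := 1)).ultrafilter_le_nhds'
      (U.map φ) hφ
    exact ⟨s, hs.1, hs'⟩
  rcases U.eventually_or.1 (Eventually.of_forall fun y => le_total (c y) 1) with h1 | h1
  · obtain ⟨s, hs, hs'⟩ := hIcc c (by filter_upwards [hcpos, h1] with y h h' using ⟨h.le, h'⟩)
    exact hlim s hs hs'
  · obtain ⟨t, ht, ht'⟩ := hIcc (fun y => (c y)⁻¹) (by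
      filter_upwards [hcpos, h1] with y h h' using ⟨(inv_pos.2 h).le, inv_le_one_of_one_le₀ h'⟩)
    rcases ht.eq_or_lt with rfl | ht
    · -- The scaling factors tend to infinity, so `z` is a recession direction of `A`.
      obtain ⟨s, hs, hsA⟩ := hrec
      have hst : Tendsto (fun y => s * (c y)⁻¹) U (𝓝 0) := by simpa using ht'.const_mul s
      have hlim1 : Tendsto (fun y => (1 - s * (c y)⁻¹) • a + s • y) U (𝓝 (a + s • z)) := by
        simpa using ((hst.const_sub 1).smul_const a).add (hid.const_smul s)
      refine hsA (hAc.mem_of_tendsto hlim1 ?_)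
      filter_upwards [hcpos, hcA, hst.eventually_lt_const one_pos] with y hy hyA hy1
      have := hA ha hyA (a := 1 - s * (c y)⁻¹) (b := s * (c y)⁻¹) (by linarith)
        (mul_nonneg hs (inv_pos.2 hy).le) (by ring)
      rwa [smul_smul, mul_assoc, inv_mul_cancel₀ hy.ne', mul_one] at this
    · exact hlim t⁻¹ (inv_pos.2 ht).le (by simpa using ht'.inv₀ ht.ne')

/-- Here `A` plays the role of the epigraph of a closed convex function that is at most `ε` at the
origin and positive on the ray through `d`; the conclusion is a linear minorant of that function
which is almost nonnegative at `d`. -/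
theorem exists_linear_minorant {E : Type*} [AddCommGroup E] [Module ℝ E]
    [TopologicalSpace E] [IsTopologicalAddGroup E] [ContinuousSMul ℝ E] [LocallyConvexSpace ℝ E]
    {A : Set (E × ℝ)} (hA : Convex ℝ A) (hAc : IsClosed A) {ε : ℝ} (hε : 0 < ε)
    (h0 : ((0 : E), ε) ∈ A) {d : E} (hd : ∀ s r : ℝ, 0 ≤ s → (s • d, r) ∈ A → 0 < r)
    {η : ℝ} (hη : 0 < η) :
    ∃ q : E →L[ℝ] ℝ, (∀ y r, (y, r) ∈ A → q y ≤ r) ∧ -η < q d := by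
  -- A hyperplane separating `(e, -η)` from the cone generated by `A`.
  have sep : ∀ e : E, (∀ s r : ℝ, 0 ≤ s → (s • e, r) ∈ A → 0 < r) →
      ∃ (φ : E →L[ℝ] ℝ) (ρ : ℝ), 0 ≤ ρ ∧ (∀ y r, (y, r) ∈ A → 0 ≤ φ y + ρ * r) ∧
        φ e < ρ * η := by
    intro e he
    have hz : (e, -η) ∉ closure (ConvexCone.hull ℝ A : Set (E × ℝ)) := by
      refine notMem_closure_hull hA hAc h0 (fun s hs h => ?_)
        ⟨ε / η, (div_pos hε hη).le, fun h => ?_⟩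
      · have := he s (s * -η) hs (by simpa using h)
        nlinarith
      -- Moving from `(0, ε)` along `(e, -η)` for the time `ε / η` reaches height `0`.
      · have h' : ((ε / η) • e, (0 : ℝ)) ∈ A := by
          have e1 : ε + ε / η * -η = 0 := by field_simp; ring
          simpa [-mul_neg, e1] using h
        exact lt_irrefl _ (he _ _ (div_pos hε hη).le h')
    obtain ⟨ψ, u, hu, hψ⟩ := geometric_hahn_banach_point_closed
      (ConvexCone.hull ℝ A).convex.closure isClosed_closure hz
    have hcone : ∀ a ∈ A, 0 ≤ ψ a := by
      intro a ha
      by_contra! hneg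
      have hs : 0 < (|u| + 1) / -ψ a := by have := abs_nonneg u; apply div_pos <;> linarith
      have := hψ _ (subset_closure (smul_mem_hull ha hs))
      rw [map_smul, smul_eq_mul, div_neg, neg_mul, div_mul_cancel₀ _ hneg.ne] at this
      linarith [neg_abs_le u]
    have hu0 : u ≤ 0 := by
      have hlim : Tendsto (fun s : ℝ => ψ (s • ((0 : E), ε))) (𝓝[>] 0) (𝓝 0) := by
        have : Continuous fun s : ℝ => ψ (s • ((0 : E), ε)) := by fun_prop
        simpa using (this.tendsto 0).mono_left nhdsWithin_le_nhds
      refine ge_of_tendsto hlim ?_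
      filter_upwards [self_mem_nhdsWithin] with s hs
      exact (hψ _ (subset_closure (smul_mem_hull h0 hs))).le
    have hsplit : ∀ y r, ψ (y, r) = ψ (y, 0) + ψ (0, 1) * r := by
      intro y r
      have : (y, r) = (y, (0 : ℝ)) + r • ((0 : E), (1 : ℝ)) := by simp
      rw [this, map_add, map_smul, smul_eq_mul, mul_comm]
    refine ⟨ψ.comp (ContinuousLinearMap.inl ℝ E ℝ), ψ (0, 1), ?_, fun y r h => ?_, ?_⟩
    · have h1 := hcone _ h0
      rw [hsplit] at h1
      have h2 : ψ ((0 : E), (0 : ℝ)) = 0 := map_zero ψ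
      rw [h2, zero_add] at h1
      exact nonneg_of_mul_nonneg_left h1 hε
    · have := hcone _ h
      rw [hsplit] at this
      simpa using this
    · rw [hsplit] at hu
      simp only [ContinuousLinearMap.comp_apply, ContinuousLinearMap.inl_apply]
      linarith
  have scale : ∀ (φ : E →L[ℝ] ℝ) (ρ : ℝ), 0 < ρ → (∀ y r, (y, r) ∈ A → 0 ≤ φ y + ρ * r) →
      ∀ y r, (y, r) ∈ A → (-ρ⁻¹ • φ) y ≤ r := by
    intro φ ρ hρ h y r hyr
    have h1 := mul_nonneg (inv_pos.2 hρ).le (h y r hyr)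
    rw [mul_add, ← mul_assoc, inv_mul_cancel₀ hρ.ne', one_mul] at h1
    simp only [_root_.smul_apply, smul_eq_mul]
    linarith
  obtain ⟨φ, ρ, hρ, hφA, hφd⟩ := sep d hd
  rcases hρ.eq_or_lt with rfl | hρ
  · -- The separating hyperplane is vertical: tilt an arbitrary minorant, which exists because a
    -- hyperplane separating `(0, -η)` cannot be vertical.
    obtain ⟨φ₀, ρ₀, hρ₀, hφ₀A, hφ₀⟩ := sep 0 (fun s r hs h => hd 0 r le_rfl (by simpa using h))
    have hρ₀' : 0 < ρ₀ := by
      rw [map_zero] at hφ₀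
      exact pos_of_mul_pos_left hφ₀ hη.le
    have hq₀ := scale φ₀ ρ₀ hρ₀' hφ₀A
    set q₀ := -ρ₀⁻¹ • φ₀
    rw [zero_mul] at hφd
    refine ⟨q₀ - (|q₀ d| / -φ d) • φ, fun y r h => ?_, ?_⟩
    · have h1 := hφA y r h
      have h2 := mul_nonneg (div_nonneg (abs_nonneg (q₀ d)) (neg_pos.2 hφd).le) h1
      have h3 := hq₀ y r h
      simp only [_root_.sub_apply, _root_.smul_apply, smul_eq_mul]
      rw [zero_mul, add_zero] at h2
      linarith
    · simp only [_root_.sub_apply, _root_.smul_apply, smul_eq_mul]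
      rw [div_neg, neg_mul, div_mul_cancel₀ _ hφd.ne]
      linarith [neg_abs_le (q₀ d)]
  · refine ⟨-ρ⁻¹ • φ, scale φ ρ hρ hφA, ?_⟩
    simp only [_root_.smul_apply, smul_eq_mul]
    have := mul_lt_mul_of_pos_left hφd (inv_pos.2 hρ)
    rw [← mul_assoc, inv_mul_cancel₀ hρ.ne', one_mul] at this
    linarith

/-! ### Approximate subgradients -/

section Epigraph

variable {E : Type*} [AddCommGroup E] [Module ℝ E] [TopologicalSpace E]

/-- One half of the formula for the support function of `∂_ε g(x)`: it is nonnegative at `d` when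
`cl g` does not drop by `ε` or more along the ray from `x` in direction `d`. -/
theorem exists_mem_epsSubdiff_lt [IsTopologicalAddGroup E] [ContinuousSMul ℝ E]
    [LocallyConvexSpace ℝ E] {g : E → EReal} (hconv : IsConvex g) (hbot : ∀ y, g y ≠ ⊥)
    {x d : E} (hx : g x ≠ ⊤) {ε : ℝ} (hε : 0 < ε)
    (hd : ∀ s : ℝ, 0 ≤ s → g x - ε < lscHull g (x + s • d)) {η : ℝ} (hη : 0 < η) :
    ∃ q ∈ epsSubdiff ε g x, -η < q d := by
  obtain ⟨v, hv⟩ : ∃ v : ℝ, g x = v := ⟨(g x).toReal, (EReal.coe_toReal hx (hbot x)).symm⟩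
  let T : E × ℝ → E × ℝ := fun p => (x, v - ε) + p
  have hT : Continuous T := by fun_prop
  have hA : Convex ℝ (T ⁻¹' closure (epi g)) := by
    have := (show Convex ℝ (epi g) from hconv).closure.translate_preimage_right (x, v - ε)
    exact this
  have hrec : ∀ s r : ℝ, 0 ≤ s → (s • d, r) ∈ T ⁻¹' closure (epi g) → 0 < r := by
    intro s r hs h
    have h1 : lscHull g (x + s • d) ≤ ((v - ε + r : ℝ) : EReal) := by
      have : (x + s • d, v - ε + r) ∈ epi (lscHull g) := by rw [epi_lscHull]; exact h
      exact this
    have h2 := (hd s hs).trans_le h1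
    rw [hv, ← EReal.coe_sub, EReal.coe_lt_coe_iff] at h2
    linarith
  obtain ⟨q, hq, hqd⟩ := exists_linear_minorant hA (isClosed_closure.preimage hT) hε
    (d := d) (subset_closure (by simp [T, epi, hv])) hrec hη
  · refine ⟨q, ⟨hbot x, hx, fun y => ?_⟩, hqd⟩
    rw [hv, EReal.le_sub_iff_add_le (by simp) (by simp)]
    refine EReal.le_of_forall_lt_iff_le.1 fun r hr => ?_
    have := hq (y - x) (r - v + ε) (subset_closure (by
      simpa [T, epi] using hr.le))
    rw [← EReal.coe_add, EReal.coe_le_coe_iff]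
    change q (y - x) - ε + v ≤ r
    linarith

theorem convex_epsSubdiff (ε : ℝ) (f : E → EReal) (x : E) : Convex ℝ (epsSubdiff ε f x) := by
  rintro p ⟨h1, h2, hp⟩ q ⟨-, -, hq⟩ a b ha hb hab
  refine ⟨h1, h2, fun y => ?_⟩
  refine le_trans ?_ (max_le (hp y) (hq y))
  rw [← EReal.coe_strictMono.monotone.map_max, EReal.coe_le_coe_iff]
  change a * p (y - x) + b * q (y - x) - ε ≤ _
  have h3 := Convex.combo_le_max (p (y - x) - ε) (q (y - x) - ε) ha hb hab
  simp only [smul_eq_mul] at h3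
  linear_combination h3 + ε * hab

/-- The Fenchel inequality, reversed up to `ε`, at an `ε`-subgradient. -/
theorem le_neg_conj_of_mem_epsSubdiff {f : E → EReal} {ε : ℝ} {x : E}
    {q : WeakDual ℝ E} (hq : q ∈ epsSubdiff ε f x) : f x + ((-(q x) - ε : ℝ) : EReal) ≤ -conj f q := by
  obtain ⟨hbot, htop, h⟩ := hq
  rw [EReal.le_neg]
  refine iSup_le fun y => ?_
  have h1 := h y
  obtain ⟨v, hv⟩ : ∃ v : ℝ, f x = v := ⟨(f x).toReal, (EReal.coe_toReal htop hbot).symm⟩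
  rw [hv] at h1 ⊢
  induction hy : f y with
  | bot =>
    rw [hy, EReal.bot_sub] at h1
    exact absurd h1 (by simpa only [le_bot_iff] using EReal.coe_ne_bot _)
  | top => simp
  | coe r =>
    rw [hy] at h1
    norm_cast at h1 ⊢
    rw [map_sub] at h1
    linarith

end Epigraph

/-! ### Separable sums, orthogonality and duality in products -/

section Product

variable {m : ℕ} {X : Fin m → Type*}

theorem sum_ne_bot {ι : Type*} {s : Finset ι} {a : ι → EReal} (h : ∀ i ∈ s, a i ≠ ⊥) :
    ∑ i ∈ s, a i ≠ ⊥ :=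
  Finset.sum_induction a (· ≠ ⊥) (fun _ _ ha hb => by simp [EReal.add_eq_bot_iff, ha, hb]) (by simp) h

theorem ne_top_of_sum_ne_top {ι : Type*} [DecidableEq ι] {s : Finset ι} {a : ι → EReal}
    (h : ∀ i, a i ≠ ⊥) (hs : ∑ i ∈ s, a i ≠ ⊤) {i : ι} (hi : i ∈ s) : a i ≠ ⊤ := by
  intro hai
  rw [← Finset.add_sum_erase s a hi, hai, EReal.top_add_of_ne_bot (sum_ne_bot fun j _ => h j)] at hs
  exact hs rfl

theorem coe_sum {ι : Type*} (s : Finset ι) (a : ι → ℝ) :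
    ((∑ i ∈ s, a i : ℝ) : EReal) = ∑ i ∈ s, (a i : EReal) :=
  map_sum (⟨⟨Real.toEReal, rfl⟩, EReal.coe_add⟩ : ℝ →+ EReal) a s

variable [∀ i, AddCommGroup (X i)] [∀ i, Module ℝ (X i)]

theorem isConvex_sepSum {f : ∀ i, X i → EReal} (hproper : ∀ i, IsProper (f i))
    (hconvex : ∀ i, IsConvex (f i)) : IsConvex (sepSum f) := by
  have key : ∀ p ∈ epi (sepSum f), ∃ r : Fin m → ℝ, (∀ i, f i (p.1 i) = r i) ∧ ∑ i, r i ≤ p.2 := by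
    intro p hp
    have hp' : ∑ i, f i (p.1 i) ≤ (p.2 : EReal) := hp
    have hr : ∀ i, f i (p.1 i) = ((f i (p.1 i)).toReal : EReal) := fun i =>
      (EReal.coe_toReal (ne_top_of_sum_ne_top (a := fun i => f i (p.1 i))
        (fun i => ((hproper i).1 _).ne') (hp'.trans_lt (EReal.coe_lt_top _)).ne
        (Finset.mem_univ i)) ((hproper i).1 _).ne').symm
    refine ⟨fun i => (f i (p.1 i)).toReal, hr, ?_⟩
    rw [Finset.sum_congr rfl fun i _ => hr i, ← coe_sum, EReal.coe_le_coe_iff] at hp'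
    exact hp'
  intro p hp q hq a b ha hb hab
  obtain ⟨r, hr, hrp⟩ := key p hp
  obtain ⟨t, ht, htq⟩ := key q hq
  have h1 : ∀ i, f i (a • p.1 i + b • q.1 i) ≤ ((a * r i + b * t i : ℝ) : EReal) := fun i =>
    hconvex i (x := (p.1 i, r i)) (hr i).le (y := (q.1 i, t i)) (ht i).le ha hb hab
  change ∑ i, f i (a • p.1 i + b • q.1 i) ≤ ((a * p.2 + b * q.2 : ℝ) : EReal)
  refine (Finset.sum_le_sum fun i _ => h1 i).trans ?_
  rw [← coe_sum, EReal.coe_le_coe_iff, Finset.sum_add_distrib, ← Finset.mul_sum, ← Finset.mul_sum]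
  gcongr

variable [∀ i, TopologicalSpace (X i)]

/-- The `i`-th component of a functional on `∏ Xᵢ`, that is, its restriction to the `i`-th factor;
`component` realizes the identification of the dual of `∏ Xᵢ` with `∏ Xᵢ^*`. -/
def component (q : WeakDual ℝ (∀ i, X i)) (i : Fin m) : WeakDual ℝ (X i) :=
  ContinuousLinearMap.comp (q : (∀ i, X i) →L[ℝ] ℝ) (ContinuousLinearMap.single ℝ X i)

theorem component_apply (q : WeakDual ℝ (∀ i, X i)) (i : Fin m) (y : X i) :
    component q i y = q (Pi.single i y) := rfl

theorem sum_component_apply (q : WeakDual ℝ (∀ i, X i)) (x : ∀ i, X i) :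
    ∑ i, component q i (x i) = q x := by
  simp only [component_apply, ← map_sum, Finset.univ_sum_single]

/-- `∂_ε (∑ fᵢ)(x) ⊆ ∏ ∂_ε fᵢ(xᵢ)`: test with points differing from `x` in one coordinate. -/
theorem component_mem_epsSubdiff {f : ∀ i, X i → EReal} (hproper : ∀ i, IsProper (f i)) {ε : ℝ}
    {x : ∀ i, X i} {q : WeakDual ℝ (∀ i, X i)} (hq : q ∈ epsSubdiff ε (sepSum f) x) (i : Fin m) :
    component q i ∈ epsSubdiff ε (f i) (x i) := by
  obtain ⟨-, htop, h⟩ := hq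
  have hbot : ∀ i y, f i y ≠ ⊥ := fun i y => ((hproper i).1 y).ne'
  have hfin : ∀ j, f j (x j) ≠ ⊤ := fun j =>
    ne_top_of_sum_ne_top (a := fun i => f i (x i)) (fun i => hbot i _) htop (Finset.mem_univ j)
  refine ⟨hbot i _, hfin i, fun y => ?_⟩
  have h1 := h (Function.update x i y)
  have h2 : Function.update x i y - x = Pi.single i (y - x i) := by
    ext j
    by_cases hj : j = i
    · subst hj; simp
    · simp [hj]
  rw [h2] at h1
  rw [component_apply]
  refine h1.trans ?_
  have hc : ∀ j, f j (x j) = ((f j (x j)).toReal : EReal) := fun j =>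
    (EReal.coe_toReal (hfin j) (hbot j _)).symm
  have e1 : sepSum f (Function.update x i y) =
      f i y + ((∑ j ∈ Finset.univ.erase i, (f j (x j)).toReal : ℝ) : EReal) := by
    rw [sepSum, ← Finset.add_sum_erase _ _ (Finset.mem_univ i), coe_sum]
    congr 1
    · simp
    · refine Finset.sum_congr rfl fun j hj => ?_
      rw [Function.update_of_ne (Finset.ne_of_mem_erase hj), ← hc]
  have e2 : sepSum f x =
      f i (x i) + ((∑ j ∈ Finset.univ.erase i, (f j (x j)).toReal : ℝ) : EReal) := by
    rw [sepSum, ← Finset.add_sum_erase _ _ (Finset.mem_univ i), coe_sum]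
    congr 1
    exact Finset.sum_congr rfl fun j _ => hc j
  rw [e1, e2, hc i]
  generalize (∑ j ∈ Finset.univ.erase i, (f j (x j)).toReal : ℝ) = c
  induction hy : f i y with
  | bot => exact absurd hy (hbot i y)
  | top => simp
  | coe r =>
    norm_cast
    linarith

/-- The dual of `∏ Xᵢ^*`, with the product of the weak-* topologies, is `∏ Xᵢ`. -/
theorem exists_dual_representation (φ : (∀ i, WeakDual ℝ (X i)) →L[ℝ] ℝ) :
    ∃ d : ∀ i, X i, ∀ p, φ p = ∑ i, p i (d i) := by
  have h : ∀ i, ∃ d : X i, ∀ p : WeakDual ℝ (X i), φ (Pi.single i p) = p d := by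
    intro i
    obtain ⟨d, hd⟩ := LinearMap.dualEmbedding_surjective (topDualPairing ℝ (X i))
      (φ.comp (ContinuousLinearMap.single ℝ (fun i => WeakDual ℝ (X i)) i))
    exact ⟨d, fun p => (DFunLike.congr_fun hd p).symm⟩
  choose d hd using h
  refine ⟨d, fun p => ?_⟩
  simp only [← hd, ← map_sum, Finset.univ_sum_single]

/-- The bipolar inclusion `S^⊥⊥ ⊆ S` for a closed subspace `S`. -/
theorem mem_of_forall_orthogonal [∀ i, IsTopologicalAddGroup (X i)] [∀ i, ContinuousSMul ℝ (X i)]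
    [∀ i, LocallyConvexSpace ℝ (X i)] {S : Submodule ℝ (∀ i, X i)}
    (hS : IsClosed (S : Set (∀ i, X i))) {d : ∀ i, X i}
    (hd : ∀ p ∈ orthogonal S, ∑ i, p i (d i) = 0) : d ∈ S := by
  by_contra hdS
  obtain ⟨q, u, hu, hq⟩ := geometric_hahn_banach_point_closed S.convex hS hdS
  have hqS : ∀ y ∈ S, q y = 0 := by
    intro y hy
    by_contra hne
    have := hq (((u - 1) / q y) • y) (S.smul_mem _ hy)
    rw [map_smul, smul_eq_mul, div_mul_cancel₀ _ hne] at this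
    linarith
  have h1 := hd (component q) fun y hy => (sum_component_apply q y).trans (hqS y hy)
  have h2 := hq 0 S.zero_mem
  rw [map_zero] at h2
  rw [sum_component_apply q d] at h1
  have h3 : q d = 0 := h1
  linarith

theorem convex_orthogonal (S : Submodule ℝ (∀ i, X i)) : Convex ℝ (orthogonal S) := by
  intro p hp q hq a b _ _ _ x hx
  change ∑ i, (a * p i (x i) + b * q i (x i)) = 0
  rw [Finset.sum_add_distrib, ← Finset.mul_sum, ← Finset.mul_sum, hp x hx, hq x hx]
  simp

/-- If the support function of `B ⊆ ∏ Xᵢ^*` is nonnegative on `S`, then `0` lies in the weak-*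
closure of `S^⊥ + B`: a vector `d` separating the two would have to lie in `S^⊥⊥ = S`. -/
theorem zero_mem_closure_orthogonal_add [∀ i, IsTopologicalAddGroup (X i)]
    [∀ i, ContinuousSMul ℝ (X i)] [∀ i, LocallyConvexSpace ℝ (X i)] {S : Submodule ℝ (∀ i, X i)}
    (hS : IsClosed (S : Set (∀ i, X i))) {B : Set (∀ i, WeakDual ℝ (X i))} (hB : Convex ℝ B)
    (h : ∀ d ∈ S, ∀ η : ℝ, 0 < η → ∃ q ∈ B, -η < ∑ i, q i (d i)) :
    (0 : ∀ i, WeakDual ℝ (X i)) ∈ closure (orthogonal S + B) := by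
  by_contra h0
  have : ∀ i, LocallyConvexSpace ℝ (WeakDual ℝ (X i)) := fun i =>
    inferInstanceAs (LocallyConvexSpace ℝ (WeakBilin (topDualPairing ℝ (X i))))
  obtain ⟨φ, u, hu, hφ⟩ := geometric_hahn_banach_closed_point
    ((convex_orthogonal S).add hB).closure isClosed_closure h0
  rw [map_zero] at hφ
  obtain ⟨d, hd⟩ := exists_dual_representation φ
  have hφ' : ∀ p ∈ orthogonal S, ∀ q ∈ B, φ p + φ q < u := fun p hp q hq => by
    rw [← map_add]
    exact hu _ (subset_closure (Set.add_mem_add hp hq))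
  have hdS : d ∈ S := by
    refine mem_of_forall_orthogonal hS fun p hp => ?_
    rw [← hd]
    by_contra hne
    obtain ⟨q, hq, -⟩ := h 0 S.zero_mem 1 one_pos
    have hp' : ((u - φ q) / φ p) • p ∈ orthogonal S := by
      intro x hx
      change ∑ i, (u - φ q) / φ p * p i (x i) = 0
      rw [← Finset.mul_sum, hp x hx, mul_zero]
    have := hφ' _ hp' q hq
    rw [map_smul, smul_eq_mul, div_mul_cancel₀ _ hne] at this
    linarith
  obtain ⟨q, hq, hqd⟩ := h d hdS (-u) (by linarith)
  have := hφ' 0 (fun x _ => Finset.sum_eq_zero fun i _ => rfl) q hq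
  rw [map_zero, zero_add, hd q] at this
  linarith

/-- Weak duality. -/
theorem dualValue_le_primalValue (f : ∀ i, X i → EReal)
    (S : Submodule ℝ (∀ i, X i)) : dualValue f S ≤ primalValue f S := by
  refine iSup₂_le fun p hp => le_iInf₂ fun x hx => ?_
  have h1 : ∀ i, -conj (f i) (p i) ≤ f i (x i) + ((-(p i (x i)) : ℝ) : EReal) := by
    intro i
    have h2 : ((p i (x i) : ℝ) : EReal) - f i (x i) ≤ conj (f i) (p i) :=
      le_iSup (fun y => ((p i y : ℝ) : EReal) - f i y) (x i)
    refine (EReal.neg_le_neg_iff.2 h2).trans ?_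
    rw [EReal.neg_sub (by simp) (by simp), add_comm, EReal.coe_neg]
  refine (Finset.sum_le_sum fun i _ => h1 i).trans ?_
  rw [Finset.sum_add_distrib, ← coe_sum, Finset.sum_neg_distrib, hp x hx]
  simp

end Product

end ExtMonotropic

open ExtMonotropic in
theorem theorem3p2 {m : ℕ} {X : Fin m → Type*}
    [∀ i, AddCommGroup (X i)] [∀ i, Module ℝ (X i)] [∀ i, TopologicalSpace (X i)]
    [∀ i, IsTopologicalAddGroup (X i)] [∀ i, ContinuousSMul ℝ (X i)]
    [∀ i, LocallyConvexSpace ℝ (X i)] [∀ i, T2Space (X i)]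
    (f : ∀ i, X i → EReal)
    (hproper : ∀ i, ExtMonotropic.IsProper (f i))
    (hconvex : ∀ i, ExtMonotropic.IsConvex (f i))
    (S : Submodule ℝ (∀ i, X i)) (hS : IsClosed (S : Set (∀ i, X i)))
    (hfeas : (Set.univ.pi (fun i => ExtMonotropic.dom (f i)) ∩ (S : Set (∀ i, X i))).Nonempty)
    (hcl : ∀ i, ExtMonotropic.IsProper (ExtMonotropic.lscHull (f i)))
    (hg : ∀ x ∈ ExtMonotropic.dom (ExtMonotropic.lscHull (ExtMonotropic.sepSum f)) ∩
        (S : Set (∀ i, X i)),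
      ExtMonotropic.sepSum f x = ExtMonotropic.lscHull (ExtMonotropic.sepSum f) x)
    (hclosed : ∀ x ∈ Set.univ.pi (fun i => ExtMonotropic.dom (f i)) ∩ (S : Set (∀ i, X i)),
      ∀ ε : ℝ, 0 < ε →
        IsClosed (ExtMonotropic.orthogonal S +
          Set.univ.pi (fun i => ExtMonotropic.epsSubdiff ε (f i) (x i)))) :
    ExtMonotropic.primalValue f S = ExtMonotropic.dualValue f S := by
  refine le_antisymm ?_ (dualValue_le_primalValue f S)
  have hbot : ∀ x, sepSum f x ≠ ⊥ := fun x => sum_ne_bot fun i _ => ((hproper i).1 _).ne'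
  have hdom : ∀ x, sepSum f x ≠ ⊤ → x ∈ Set.univ.pi fun i => dom (f i) := fun x hx i _ =>
    (ne_top_of_sum_ne_top (a := fun i => f i (x i)) (fun i => ((hproper i).1 _).ne') hx
      (Finset.mem_univ i)).lt_top
  have hPle : ∀ x ∈ S, primalValue f S ≤ sepSum f x := fun x hx => iInf₂_le x hx
  have hPtop : primalValue f S ≠ ⊤ := by
    obtain ⟨x, hx, hxS⟩ := hfeas
    refine ((hPle x hxS).trans_lt ?_).ne
    exact Finset.sum_induction (fun i => f i (x i)) (· < ⊤) (fun _ _ ha hb => EReal.add_lt_top ha.ne hb.ne)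
      (by simp) (fun i _ => hx i trivial)
  induction hP : primalValue f S with
  | bot => exact bot_le
  | top => exact absurd hP hPtop
  | coe v =>
  -- The lower semicontinuous hull of the objective has the same infimum on `S`.
  have hPlsc : ∀ x ∈ S, (v : EReal) ≤ lscHull (sepSum f) x := by
    intro x hx
    by_cases hx' : lscHull (sepSum f) x < ⊤
    · rw [← hg x ⟨hx', hx⟩, ← hP]
      exact hPle x hx
    · rw [not_lt_top_iff.1 hx']
      exact le_top
  have main : ∀ ε : ℝ, 0 < ε → ((v - m * ε : ℝ) : EReal) ≤ dualValue f S := by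
    intro ε hε
    obtain ⟨x, hxS, hxv⟩ : ∃ x ∈ S, sepSum f x < ((v + ε : ℝ) : EReal) := by
      have : primalValue f S < ((v + ε : ℝ) : EReal) := by
        rw [hP, EReal.coe_lt_coe_iff]
        linarith
      simpa only [primalValue, iInf_lt_iff, exists_prop, sepSum] using this
    have hxtop : sepSum f x ≠ ⊤ := (hxv.trans (EReal.coe_lt_top _)).ne
    have hlt : sepSum f x - ε < v := by
      refine EReal.sub_lt_of_lt_add ?_
      simpa using hxv
    have h0 : (0 : ∀ i, WeakDual ℝ (X i)) ∈ orthogonal S +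
        Set.univ.pi (fun i => epsSubdiff ε (f i) (x i)) := by
      rw [← (hclosed x ⟨hdom x hxtop, hxS⟩ ε hε).closure_eq]
      refine zero_mem_closure_orthogonal_add hS
        (convex_pi fun i _ => convex_epsSubdiff ε (f i) (x i)) fun d hd η hη => ?_
      obtain ⟨q, hq, hqd⟩ := exists_mem_epsSubdiff_lt (isConvex_sepSum hproper hconvex) hbot hxtop
        hε (d := d) (fun s _ => hlt.trans_le (hPlsc _ (S.add_mem hxS (S.smul_mem s hd)))) hη
      refine ⟨component q, fun i _ => component_mem_epsSubdiff hproper hq i, ?_⟩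
      rwa [sum_component_apply]
    obtain ⟨p, hp, q, hq, hpq⟩ := Set.mem_add.1 h0
    have hpq' : ∀ y : ∀ i, X i, ∑ i, q i (y i) = -∑ i, p i (y i) := by
      intro y
      rw [eq_neg_iff_add_eq_zero, add_comm, ← Finset.sum_add_distrib]
      refine Finset.sum_eq_zero fun i _ => ?_
      have := DFunLike.congr_fun (congr_fun hpq i) (y i)
      exact this
    have hqS : q ∈ orthogonal S := fun y hy => by rw [hpq', hp y hy, neg_zero]
    calc ((v - m * ε : ℝ) : EReal)
        = (v : EReal) + ((∑ i, (-(q i (x i)) - ε) : ℝ) : EReal) := by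
          rw [← EReal.coe_add, Finset.sum_sub_distrib, Finset.sum_neg_distrib, hqS x hxS]
          simp [sub_eq_add_neg]
      _ ≤ sepSum f x + ((∑ i, (-(q i (x i)) - ε) : ℝ) : EReal) := by
          gcongr
          exact hP ▸ hPle x hxS
      _ = ∑ i, (f i (x i) + ((-(q i (x i)) - ε : ℝ) : EReal)) := by
          rw [Finset.sum_add_distrib, coe_sum, sepSum]
      _ ≤ ∑ i, -conj (f i) (q i) :=
          Finset.sum_le_sum fun i _ => le_neg_conj_of_mem_epsSubdiff (hq i trivial)
      _ ≤ dualValue f S :=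
          le_iSup₂ (f := fun p (_ : p ∈ orthogonal S) => ∑ i, -conj (f i) (p i)) q hqS
  have hlim : Tendsto (fun ε : ℝ => ((v - m * ε : ℝ) : EReal)) (𝓝[>] 0) (𝓝 (v : EReal)) := by
    have : Continuous fun ε : ℝ => ((v - m * ε : ℝ) : EReal) :=
      continuous_coe_real_ereal.comp (by fun_prop)
    simpa using (this.tendsto 0).mono_left nhdsWithin_le_nhds
  refine le_of_tendsto hlim ?_
  filter_upwards [self_mem_nhdsWithin] with ε hε using main ε hε
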